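/- Let $2^{\mathbb N}$ be the set of infinite binary sequences and $2^{<\mathbb N}$ the set of finite binary strings. For a string $\sigma$ let $[\![\sigma]\!]$ be the set of sequences with prefix $\sigma$, for a set $S$ of strings let $[\![S]\!]=\bigcup_{\sigma\in S}[\![\sigma]\!]$, and let $\lambda$ be the uniform measure on $2^{\mathbb N}$, so that $\lambda([\![\sigma]\!])=2^{-|\sigma|}$. A $\Sigma^0_1$ class is a set $[\![S]\!]$ with $S$ computably enumerable; a $\Pi^0_1$ class is the complement of a $\Sigma^0_1$ class. A difference test is a sequence $((\mathcal U_i,\mathcal V_i))_{i\in\mathbb N}$ of pairs of uniformly $\Sigma^0_1$ classes with $\lambda(\mathcal U_i\setminus\mathcal V_i)\le 2^{-i}$ for all $i$. A sequence $X$ is difference random if $X\notin\bigcap_i(\mathcal U_i\setminus\mathcal V_i)$ for every difference test. A continuous semi-measure is a function $\rho:2^{<\mathbb N}\to[0,1]$ that takes the value $1$ at the empty string and satisfies $\rho(\sigma)\ge\rho(\sigma0)+\rho(\sigma1)$ for all $\sigma$; it is lower semi-computable if $\rho(\sigma)=\lim_i\tilde\rho(\sigma,i)$ for some computable dyadic-valued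 $\tilde\rho$ that is non-decreasing in $i$. Let $\mathbf M$ be a universal lower semi-computable continuous semi-measure, i.e. one such that for every lower semi-computable continuous semi-measure $\rho$ there is $c\in\mathbb N$ with $\rho\le c\cdot\mathbf M$. For a $\Pi^0_1$ class $\mathcal C$ let $T=\{\sigma : [\![\sigma]\!]\cap\mathcal C\ne\emptyset\}$ be its canonical co-c.e. tree and let $T_n$ be the set of strings of length $n$ in $T$. The class $\mathcal C$ is called deep if there is a computable function $f:\mathbb N\to\mathbb N$ such that $\mathbf M(T_{f(k)})=\sum_{\sigma\in T_{f(k)}}\mathbf M(\sigma)<2^{-k}$ for all $k$. Theorem. If $X\in2^{\mathbb N}$ is difference random and $\mathcal C$ is a deep $\Pi^0_1$ class, then $X$ does not compute any member of $\mathcal C$; that is, there is no $Y\in\mathcal C$ with $Y\le_T X$. -/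

import Mathlib

namespace DeepClass

open Filter Topology
open scoped ENNReal

/-- Infinite binary sequences. -/
abbrev Cantor : Type := ℕ → Bool

/-- The string consisting of the first `n` bits of `X`. -/
def restrict (X : Cantor) (n : ℕ) : List Bool := (List.range n).map X

/-- The set of sequences having `σ` as a prefix. -/
def cylinder (σ : List Bool) : Set Cantor := {X | restrict X σ.length = σ}

/-- The open set generated by a set of strings. -/
def openOf (S : Set (List Bool)) : Set Cantor := ⋃ σ ∈ S, cylinder σ

/-- The uniform (Lebesgue) measure: the law of an infinite sequence of fair coin tosses. -/
noncomputable def lebesgue : MeasureTheory.Measure Cantor :=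
  MeasureTheory.Measure.infinitePi fun _ : ℕ => (PMF.uniformOfFintype Bool).toMeasure

/-! ### Effectively open and effectively closed classes -/

/-- A computable sequence of `Σ⁰₁` classes: each member is generated by a set of strings which is
c.e. uniformly in the index. -/
def IsUniformSigma01 (U : ℕ → Set Cantor) : Prop :=
  ∃ S : ℕ → Set (List Bool),
    REPred (fun p : ℕ × List Bool => p.2 ∈ S p.1) ∧ ∀ i, U i = openOf (S i)

/-- A `Π⁰₁` class: the complement of the open set generated by a c.e. set of strings. -/
def IsPi01 (C : Set Cantor) : Prop :=
  ∃ S : Set (List Bool), REPred (fun σ => σ ∈ S) ∧ C = (openOf S)ᶜ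

/-- The canonical co-c.e. tree of a class: the strings that are prefixes of members. -/
def canonicalTree (C : Set Cantor) : Set (List Bool) := {σ | (cylinder σ ∩ C).Nonempty}

/-- The members of length `n` of a set of strings. -/
def level (T : Set (List Bool)) (n : ℕ) : Set (List Bool) := {σ | σ ∈ T ∧ σ.length = n}

/-! ### Semi-measures -/

/-- Continuous semi-measures. -/
structure IsSemimeasure (ρ : List Bool → ℝ) : Prop where
  mem_Icc : ∀ σ, ρ σ ∈ Set.Icc (0 : ℝ) 1
  root : ρ [] = 1
  split : ∀ σ, ρ (σ ++ [false]) + ρ (σ ++ [true]) ≤ ρ σ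

/-- The dyadic rational `a / 2 ^ k` coded by the pair `(a, k)`. -/
noncomputable def dyadic (q : ℕ × ℕ) : ℝ := (q.1 : ℝ) / 2 ^ q.2

/-- `ρ` is the limit of a computable sequence of dyadic-valued functions that is non-decreasing
in the stage.  (The functions considered here are non-negative, so non-negative dyadic rationals
suffice: a negative approximation can be replaced by `0`.) -/
def IsLowerSemicomputable (ρ : List Bool → ℝ) : Prop :=
  ∃ a : List Bool → ℕ → ℕ × ℕ, Computable₂ a ∧
    (∀ σ, Monotone fun i => dyadic (a σ i)) ∧
    ∀ σ, Tendsto (fun i => dyadic (a σ i)) atTop (𝓝 (ρ σ))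

/-- Universal lower semi-computable continuous semi-measures: those that dominate every lower
semi-computable continuous semi-measure up to a multiplicative constant. -/
structure IsUniversalSemimeasure (M : List Bool → ℝ) : Prop where
  semimeasure : IsSemimeasure M
  lowerSemicomputable : IsLowerSemicomputable M
  universal : ∀ ρ : List Bool → ℝ, IsSemimeasure ρ → IsLowerSemicomputable ρ →
    ∃ c : ℕ, ∀ σ, ρ σ ≤ c * M σ

/-- `ρ(S) = ∑_{σ ∈ S} ρ(σ)` for a (non-negative) semi-measure `ρ`. -/
noncomputable def mass (ρ : List Bool → ℝ) (S : Set (List Bool)) : ℝ≥0∞ :=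
  ∑' σ : S, ENNReal.ofReal (ρ σ)

/-- `C` is a deep `Π⁰₁` class (with respect to the universal semi-measure `M`): for some computable
`f`, the level `f k` of the canonical tree of `C` has `M`-mass less than `2⁻ᵏ`, for all `k`. -/
def IsDeep (M : List Bool → ℝ) (C : Set Cantor) : Prop :=
  IsPi01 C ∧ ∃ f : ℕ → ℕ, Computable f ∧
    ∀ k, mass M (level (canonicalTree C) (f k)) < (2⁻¹ : ℝ≥0∞) ^ k

/-! ### Difference randomness -/

/-- Difference tests. -/
structure IsDifferenceTest (U V : ℕ → Set Cantor) : Prop where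
  sigma_left : IsUniformSigma01 U
  sigma_right : IsUniformSigma01 V
  measure_le : ∀ i, lebesgue (U i \ V i) ≤ (2⁻¹ : ℝ≥0∞) ^ i

/-- `X` is difference random if it passes every difference test. -/
def IsDifferenceRandom (X : Cantor) : Prop :=
  ∀ U V : ℕ → Set Cantor, IsDifferenceTest U V → X ∉ ⋂ i, U i \ V i

/-! ### Turing reducibility -/

/-- The characteristic function of a sequence, as a (total) function on `ℕ`. -/
def toFun (X : Cantor) : ℕ →. ℕ := fun n => Part.some (X n).toNat

/-- `X` computes `Y`, i.e. `Y` is Turing reducible to `X`. -/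
def Computes (X Y : Cantor) : Prop := TuringReducible (toFun Y) (toFun X)

end DeepClass

namespace DeepClass

open Filter Topology
open scoped ENNReal

/-! ### Monotone functionals with finite use -/

/-! Suppose `X` computes `Y ∈ C` through a functional, realised as a monotone string map `Ψ`
(`Computes.exists_stringMap`). The measure of the oracles whose output extends `σ` is a lower
semi-computable semi-measure in `σ`, hence at most `c * M σ`. So the oracles whose output passes
through level `f (i + c)` of the tree of `C` have measure at most `c * 2⁻¹ ^ (i + c) ≤ 2⁻¹ ^ i`
(`exists_lebesgue_le_mass`).

The tree is only co-c.e., so this class of oracles need not be open in an effective way. It contains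
a difference: `U i` holds the oracles with long enough output, `V i` those whose truncated output is
seen to leave the tree (`IsPi01.exists_coTree`, by compactness). This is a difference test. `X` lies
in every `U i`, since its output is all of `Y`, and in no `V i`, since every prefix of `Y` is in the
tree. -/

/-- Every function computable with oracle `X` is given by a primitive recursive map on finite
oracle strings which is monotone in the oracle. -/
theorem exists_functional {X : Cantor} {g : ℕ →. ℕ} (hg : Nat.RecursiveIn {toFun X} g) :
    ∃ Φ : List Bool → ℕ → Option ℕ, Primrec₂ Φ ∧
      (∀ τ τ' n y, τ <+: τ' → Φ τ n = some y → Φ τ' n = some y) ∧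
      ∀ n y, y ∈ g n → ∃ k, ∀ l ≥ k, Φ (restrict X l) n = some y := by
  induction hg with
  | zero =>
    refine ⟨fun _ _ => some 0, Primrec₂.const _, by simp, fun n y hy => ⟨0, fun l _ => ?_⟩⟩
    rw [Part.mem_some_iff.1 hy]
  | succ =>
    refine ⟨fun _ n => some (n + 1), ?_, by simp, fun n y hy => ⟨0, fun l _ => ?_⟩⟩
    · exact Primrec.option_some.comp (Primrec.succ.comp Primrec.snd)
    · rw [Part.mem_some_iff.1 hy]
  | left =>
    refine ⟨fun _ n => some n.unpair.1, ?_, by simp, fun n y hy => ⟨0, fun l _ => ?_⟩⟩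
    · exact Primrec.option_some.comp (Primrec.fst.comp (Primrec.unpair.comp Primrec.snd))
    · rw [Part.mem_some_iff.1 hy]
  | right =>
    refine ⟨fun _ n => some n.unpair.2, ?_, by simp, fun n y hy => ⟨0, fun l _ => ?_⟩⟩
    · exact Primrec.option_some.comp (Primrec.snd.comp (Primrec.unpair.comp Primrec.snd))
    · rw [Part.mem_some_iff.1 hy]
  | oracle g hg =>
    obtain rfl : g = toFun X := hg
    refine ⟨fun τ n => (τ[n]?).map Bool.toNat, ?_, ?_, fun n y hy => ⟨n + 1, fun l hl => ?_⟩⟩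
    · exact Primrec.option_map Primrec.list_getElem? ((Primrec.dom_bool _).comp Primrec.snd)
    · rintro τ τ' n y ⟨ρ, rfl⟩ h
      obtain ⟨b, hb, rfl⟩ := Option.map_eq_some_iff.1 h
      have hn : n < τ.length := (List.getElem?_eq_some_iff.1 hb).1
      simp only [List.getElem?_append_left hn, hb, Option.map_some]
    · rw [Part.mem_some_iff.1 hy]
      have : n < l := hl
      simp [restrict, this]
  | @pair f h _ _ ihf ihh =>
    obtain ⟨F, hF, mF, cF⟩ := ihf
    obtain ⟨H, hH, mH, cH⟩ := ihh
    refine ⟨fun τ n => (F τ n).bind fun a => (H τ n).map fun b => Nat.pair a b, ?_, ?_, ?_⟩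
    · exact Primrec.option_bind hF (Primrec.option_map (hH.comp (Primrec.fst.comp Primrec.fst)
        (Primrec.snd.comp Primrec.fst)) (Primrec₂.natPair.comp (Primrec.snd.comp Primrec.fst)
          Primrec.snd))
    · intro τ τ' n y hτ h
      simp only [Option.bind_eq_some_iff, Option.map_eq_some_iff] at h ⊢
      obtain ⟨a, ha, b, hb, rfl⟩ := h
      exact ⟨a, mF _ _ _ _ hτ ha, b, mH _ _ _ _ hτ hb, rfl⟩
    · intro n y hy
      simp only [Seq.seq, Functor.map, Part.mem_bind_iff, Part.mem_map_iff,
        exists_exists_and_eq_and] at hy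
      obtain ⟨a, ha, b, hb, rfl⟩ := hy
      obtain ⟨k, hk⟩ := cF n a ha
      obtain ⟨k', hk'⟩ := cH n b hb
      exact ⟨max k k', fun l hl => by
        simp [hk l (le_of_max_le_left hl), hk' l (le_of_max_le_right hl)]⟩
  | @comp f h _ _ ihf ihh =>
    obtain ⟨F, hF, mF, cF⟩ := ihf
    obtain ⟨H, hH, mH, cH⟩ := ihh
    refine ⟨fun τ n => (H τ n).bind (F τ), ?_, ?_, ?_⟩
    · exact Primrec.option_bind hH (hF.comp (Primrec.fst.comp Primrec.fst) Primrec.snd)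
    · intro τ τ' n y hτ h
      simp only [Option.bind_eq_some_iff] at h ⊢
      obtain ⟨a, ha, hb⟩ := h
      exact ⟨a, mH _ _ _ _ hτ ha, mF _ _ _ _ hτ hb⟩
    · intro n y hy
      obtain ⟨a, ha, hb⟩ := Part.mem_bind_iff.1 hy
      obtain ⟨k, hk⟩ := cH n a ha
      obtain ⟨k', hk'⟩ := cF a y hb
      exact ⟨max k k', fun l hl => by
        simp [hk l (le_of_max_le_left hl), hk' l (le_of_max_le_right hl)]⟩
  | @prec f h _ _ ihf ihh =>
    obtain ⟨F, hF, mF, cF⟩ := ihf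
    obtain ⟨H, hH, mH, cH⟩ := ihh
    let R : List Bool → ℕ → ℕ → Option ℕ := fun τ a n => n.rec (F τ a) fun y IH =>
      IH.bind fun i => H τ (Nat.pair a (Nat.pair y i))
    refine ⟨fun τ p => R τ p.unpair.1 p.unpair.2, ?_, ?_, ?_⟩
    · have u1 : Primrec fun q : List Bool × ℕ => q.2.unpair.1 :=
        Primrec.fst.comp (Primrec.unpair.comp Primrec.snd)
      have u2 : Primrec fun q : List Bool × ℕ => q.2.unpair.2 :=
        Primrec.snd.comp (Primrec.unpair.comp Primrec.snd)
      refine Primrec.nat_rec' (h := fun q r => r.2.bind fun i =>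
        H q.1 (Nat.pair q.2.unpair.1 (Nat.pair r.1 i))) u2 (hF.comp Primrec.fst u1) ?_
      refine Primrec.option_bind (Primrec.snd.comp Primrec.snd) ?_
      refine hH.comp (Primrec.fst.comp (Primrec.fst.comp Primrec.fst)) ?_
      exact Primrec₂.natPair.comp (u1.comp (Primrec.fst.comp Primrec.fst))
        (Primrec₂.natPair.comp (Primrec.fst.comp (Primrec.snd.comp Primrec.fst)) Primrec.snd)
    · intro τ τ' p y hτ
      dsimp only
      generalize p.unpair.1 = a
      generalize p.unpair.2 = n
      induction n generalizing y with
      | zero => exact mF _ _ _ _ hτ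
      | succ n ih =>
        intro h
        obtain ⟨i, hi, hy⟩ := Option.bind_eq_some_iff.1 h
        exact Option.bind_eq_some_iff.2 ⟨i, ih i hi, mH _ _ _ _ hτ hy⟩
    · intro p y
      dsimp only
      generalize p.unpair.1 = a
      generalize p.unpair.2 = n
      induction n generalizing y with
      | zero => exact cF a y
      | succ n ih =>
        intro hy
        obtain ⟨i, hi, hy⟩ := Part.mem_bind_iff.1 hy
        obtain ⟨k, hk⟩ := ih i hi
        obtain ⟨k', hk'⟩ := cH _ y hy
        exact ⟨max k k', fun l hl => Option.bind_eq_some_iff.2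
          ⟨i, hk l (le_of_max_le_left hl), hk' l (le_of_max_le_right hl)⟩⟩
  | @rfind f _ ihf =>
    obtain ⟨F, hF, mF, cF⟩ := ihf
    -- The search stops at the first value that is zero or undefined (`getD 0`); the result is
    -- accepted only if that value is a genuine zero. An undefined value is never skipped, so a
    -- longer oracle cannot reveal an earlier zero. If the bounded search fails, it returns
    -- `τ.length`.
    let I : List Bool → ℕ → ℕ := fun τ a =>
      (List.range τ.length).findIdx fun m => decide ((F τ (Nat.pair a m)).getD 0 = 0)
    have spec : ∀ τ a m, m ≤ τ.length → F τ (Nat.pair a m) = some 0 →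
        (∀ j < m, (F τ (Nat.pair a j)).getD 0 ≠ 0) → I τ a = m := by
      intro τ a m hm h0 hj
      rcases hm.lt_or_eq with hlt | rfl
      · refine (List.findIdx_eq (by simpa using hlt)).2 ⟨by simp [h0], fun j hj' => ?_⟩
        simpa using hj j hj'
      · rw [← List.length_range (n := τ.length)]
        refine List.findIdx_eq_length.2 fun j hj' => ?_
        simpa using hj j (List.mem_range.1 hj')
    have lt : ∀ τ a, ∀ j < I τ a, (F τ (Nat.pair a j)).getD 0 ≠ 0 := by
      intro τ a j hj
      have := List.not_of_lt_findIdx hj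
      simpa using this
    have le : ∀ τ a, I τ a ≤ τ.length := fun τ a => by
      simpa using List.findIdx_le_length (xs := List.range τ.length)
        (p := fun m => decide ((F τ (Nat.pair a m)).getD 0 = 0))
    have prI : Primrec₂ I := by
      refine Primrec.list_findIdx (Primrec.list_range.comp
        (Primrec.list_length.comp Primrec.fst)) ?_
      refine Primrec.eq.decide.comp (Primrec.option_getD.comp (hF.comp
        (Primrec.fst.comp Primrec.fst) (Primrec₂.natPair.comp (Primrec.snd.comp Primrec.fst)
          Primrec.snd)) (Primrec.const 0)) (Primrec.const 0)
    refine ⟨fun τ a => if F τ (Nat.pair a (I τ a)) = some 0 then some (I τ a) else none,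
      ?_, ?_, ?_⟩
    · exact Primrec.ite (Primrec.eq.comp (hF.comp Primrec.fst (Primrec₂.natPair.comp Primrec.snd
        prI)) (Primrec.const _)) (Primrec.option_some.comp prI) (Primrec.const _)
    · intro τ τ' a m hτ h
      dsimp only at h ⊢
      split_ifs at h with h0
      obtain rfl := Option.some_injective _ h
      have : I τ' a = I τ a := by
        refine spec τ' a _ ((le τ a).trans hτ.length_le) (mF _ _ _ _ hτ h0) fun j hj => ?_
        have := lt τ a j hj
        rcases hv : F τ (Nat.pair a j) with _ | v
        · simp [hv] at this
        · rw [mF _ _ _ _ hτ hv]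
          simpa [hv] using this
      rw [this, if_pos (mF _ _ _ _ hτ h0)]
    · intro a m hm
      obtain ⟨h0, hj⟩ := Nat.mem_rfind.1 hm
      have h0' : 0 ∈ f (Nat.pair a m) := by
        obtain ⟨v, hv, hv'⟩ := (Part.mem_map_iff _).1 h0
        simp only [decide_eq_true_eq] at hv'
        exact hv' ▸ hv
      have hj' : ∀ j, ∃ k, j < m → ∀ l ≥ k, (F (restrict X l) (Nat.pair a j)).getD 0 ≠ 0 := by
        intro j
        by_cases hjm : j < m
        · obtain ⟨v, hv, hv'⟩ := (Part.mem_map_iff _).1 (hj hjm)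
          obtain ⟨k, hk⟩ := cF _ v hv
          refine ⟨k, fun _ l hl => ?_⟩
          rw [hk l hl]
          simpa using hv'
        · exact ⟨0, fun h => absurd h hjm⟩
      choose k hk using hj'
      obtain ⟨k₀, hk₀⟩ := cF _ 0 h0'
      -- The bound `m` is needed because the search is capped by the length of the oracle string.
      refine ⟨max (max k₀ m) ((Finset.range m).sup k), fun l hl => ?_⟩
      have l1 : k₀ ≤ l := (le_max_left _ _).trans ((le_max_left _ _).trans hl)
      have l2 : m ≤ l := (le_max_right _ _).trans ((le_max_left _ _).trans hl)
      have : I (restrict X l) a = m := by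
        refine spec _ _ _ (by simpa [restrict] using l2) (hk₀ l l1) fun j hj => ?_
        exact hk j hj l ((Finset.le_sup (Finset.mem_range.2 hj)).trans
          ((le_max_right _ _).trans hl))
      dsimp only
      rw [this, if_pos (hk₀ l l1)]

theorem restrict_prefix (X : Cantor) {m n : ℕ} (h : m ≤ n) : restrict X m <+: restrict X n := by
  refine List.IsPrefix.map _ ?_
  rw [List.prefix_iff_eq_take]
  simp [List.take_range, h]

@[simp] theorem length_restrict (X : Cantor) (n : ℕ) : (restrict X n).length = n := by
  simp [restrict]

theorem take_restrict (X : Cantor) {m n : ℕ} (h : m ≤ n) :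
    (restrict X n).take m = restrict X m := by
  have := List.prefix_iff_eq_take.1 (restrict_prefix X h)
  rw [length_restrict] at this
  exact this.symm

/-- If `X` computes `Y`, then there is a primitive recursive map on strings, monotone for the
prefix order, which maps prefixes of `X` to arbitrarily long prefixes of `Y`. -/
theorem Computes.exists_stringMap {X Y : Cantor} (h : Computes X Y) :
    ∃ Ψ : List Bool → List Bool, Primrec Ψ ∧ (∀ τ τ', τ <+: τ' → Ψ τ <+: Ψ τ') ∧
      ∀ n, ∃ k, restrict Y n <+: Ψ (restrict X k) := by
  obtain ⟨F, hF, mF, cF⟩ := exists_functional (RecursiveIn.iff_nat.1 h)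
  -- Length of the longest initial segment on which `F τ` is defined, capped by `τ.length` to keep
  -- it primitive recursive. Only these bits are output.
  let I : List Bool → ℕ := fun τ => (List.range τ.length).findIdx fun m => (F τ m).isNone
  have le : ∀ τ, I τ ≤ τ.length := fun τ => by
    simpa using List.findIdx_le_length (xs := List.range τ.length) (p := fun m => (F τ m).isNone)
  have lt : ∀ τ, ∀ j < I τ, ∃ v, F τ j = some v := by
    intro τ j hj
    have := List.not_of_lt_findIdx hj
    simpa [Option.isSome_iff_exists, ← Option.not_isSome] using this
  have ge : ∀ τ n, n ≤ τ.length → (∀ j < n, ∃ v, F τ j = some v) → n ≤ I τ := by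
    intro τ n hn h
    by_contra! hlt
    have hl : I τ < (List.range τ.length).length := by simpa using hlt.trans_le hn
    have := List.findIdx_getElem (w := hl)
    obtain ⟨v, hv⟩ := h _ hlt
    simp only [List.getElem_range] at this
    change (F τ (I τ)).isNone = true at this
    simp [hv] at this
  have prI : Primrec I := by
    refine Primrec.list_findIdx (Primrec.list_range.comp Primrec.list_length) ?_
    exact (Primrec.not.comp (Primrec.option_isSome.comp hF)).of_eq fun p => by simp
  refine ⟨fun τ => (List.range (I τ)).map fun n => decide (F τ n = some 1), ?_, ?_, ?_⟩
  · exact Primrec.list_map (Primrec.list_range.comp prI)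
      (Primrec.eq.decide.comp hF (Primrec.const _))
  · intro τ τ' hτ
    have hI : I τ ≤ I τ' := ge _ _ ((le τ).trans hτ.length_le) fun j hj => by
      obtain ⟨v, hv⟩ := lt τ j hj
      exact ⟨v, mF _ _ _ _ hτ hv⟩
    have : (List.range (I τ)).map (fun n => decide (F τ n = some 1)) =
        (List.range (I τ)).map (fun n => decide (F τ' n = some 1)) := by
      refine List.map_congr_left fun j hj => ?_
      obtain ⟨v, hv⟩ := lt τ j (List.mem_range.1 hj)
      rw [hv, mF _ _ _ _ hτ hv]
    dsimp only
    rw [this]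
    exact restrict_prefix (fun n => decide (F τ' n = some 1)) hI
  · intro n
    choose k hk using fun j => cF j _ (Part.mem_some _)
    let K := max n ((Finset.range n).sup k)
    have hK : ∀ j < n, F (restrict X K) j = some (Y j).toNat := fun j hj =>
      hk j K ((Finset.le_sup (Finset.mem_range.2 hj)).trans (le_max_right _ _))
    refine ⟨K, ?_⟩
    have hn : n ≤ I (restrict X K) :=
      ge _ _ (by simp [K]) fun j hj => ⟨_, hK j hj⟩
    have : restrict Y n = restrict (fun j => decide (F (restrict X K) j = some 1)) n := by
      refine List.map_congr_left fun j hj => ?_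
      rw [hK j (List.mem_range.1 hj)]
      cases Y j <;> simp
    rw [this]
    exact restrict_prefix _ hn

/-! ### Strings of a given length and the uniform measure -/

/-- The list of all strings of length `n`. -/
def strings : ℕ → List (List Bool)
  | 0 => [[]]
  | n + 1 => (strings n).flatMap fun τ => [τ ++ [false], τ ++ [true]]

theorem mem_strings {n : ℕ} {τ : List Bool} : τ ∈ strings n ↔ τ.length = n := by
  induction n generalizing τ with
  | zero => simp [strings]
  | succ n ih =>
    simp only [strings, List.mem_flatMap, ih, List.mem_cons, List.not_mem_nil, or_false]
    constructor
    · rintro ⟨τ, rfl, rfl | rfl⟩ <;> simp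
    · intro h
      have hne : τ ≠ [] := by
        rintro rfl
        simp at h
      refine ⟨τ.dropLast, by simp [h], ?_⟩
      have := List.dropLast_append_getLast hne
      cases hl : τ.getLast hne <;> rw [hl] at this <;> simp [this]

theorem nodup_strings (n : ℕ) : (strings n).Nodup := by
  induction n with
  | zero => simp [strings]
  | succ n ih =>
    refine List.nodup_flatMap.2 ⟨fun τ _ => by simp, ih.imp fun {a b} hab => ?_⟩
    simp only [Function.onFun, List.disjoint_left, List.mem_cons, List.not_mem_nil, or_false]
    rintro x (rfl | rfl) (h | h) <;> simp_all

theorem primrec_strings : Primrec strings := by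
  have : Primrec fun n : ℕ => (Nat.rec [[]] (fun _ L => L.flatMap fun τ =>
      [τ ++ [false], τ ++ [true]]) n : List (List Bool)) := by
    refine Primrec.nat_rec' (h := fun _ (r : ℕ × List (List Bool)) => r.2.flatMap fun τ => [τ ++ [false], τ ++ [true]])
      Primrec.id (Primrec.const _) ?_
    refine Primrec.list_flatMap (Primrec.snd.comp Primrec.snd) ?_
    have c : ∀ b : Bool, Primrec fun q : (ℕ × ℕ × List (List Bool)) × List Bool => q.2 ++ [b] :=
      fun b => Primrec.list_concat.comp Primrec.snd (Primrec.const b)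
    exact Primrec.list_cons.comp (c false) (Primrec.list_cons.comp (c true) (Primrec.const []))
  refine this.of_eq fun n => ?_
  induction n with
  | zero => rfl
  | succ n ih => simp only [strings, ← ih]

theorem primrecRel_prefix : PrimrecRel fun σ τ : List Bool => σ <+: τ :=
  (Primrec.eq.comp Primrec.fst (Primrec.list_take.comp
    (Primrec.list_length.comp Primrec.fst) Primrec.snd)).of_eq fun _ =>
      List.prefix_iff_eq_take.symm

theorem mem_cylinder {σ : List Bool} {Z : Cantor} : Z ∈ cylinder σ ↔ restrict Z σ.length = σ :=
  Iff.rfl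

theorem cylinder_eq_pi (σ : List Bool) :
    cylinder σ = Set.pi (Finset.range σ.length) fun i => {σ.getD i false} := by
  ext Z
  rw [mem_cylinder]
  constructor
  · intro h i hi
    have hi' : i < σ.length := by simpa using hi
    rw [Set.mem_singleton_iff]
    conv_rhs => rw [← h]
    simp [restrict, hi']
  · intro h
    refine List.ext_getElem (by simp) fun i h1 h2 => ?_
    have := h i (by simpa using h2)
    simpa [restrict, h2] using this

theorem measurableSet_cylinder (σ : List Bool) : MeasurableSet (cylinder σ) := by
  rw [cylinder_eq_pi]
  exact MeasurableSet.pi (Finset.countable_toSet _) fun _ _ => MeasurableSet.singleton _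

instance : MeasureTheory.IsProbabilityMeasure lebesgue := by
  unfold lebesgue
  infer_instance

theorem lebesgue_cylinder (σ : List Bool) : lebesgue (cylinder σ) = 2⁻¹ ^ σ.length := by
  rw [cylinder_eq_pi, lebesgue, MeasureTheory.Measure.infinitePi_pi]
  · simp
  · exact fun _ _ => MeasurableSet.singleton _

theorem setOf_restrict_eq (p : List Bool → Prop) [DecidablePred p] (n : ℕ) :
    {Z | p (restrict Z n)} = ⋃ τ ∈ ((strings n).filter (p ·)).toFinset, cylinder τ := by
  ext Z
  simp only [Set.mem_ofPred_eq, List.mem_toFinset, List.mem_filter, mem_strings, decide_eq_true_eq,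
    Set.mem_iUnion, mem_cylinder, exists_prop]
  constructor
  · exact fun h => ⟨_, ⟨length_restrict _ _, h⟩, by simp⟩
  · rintro ⟨τ, ⟨rfl, h⟩, hτ⟩
    rwa [hτ]

theorem measurableSet_restrict (p : List Bool → Prop) (n : ℕ) :
    MeasurableSet {Z | p (restrict Z n)} := by
  classical
  rw [setOf_restrict_eq]
  exact Finset.measurableSet_biUnion _ fun τ _ => measurableSet_cylinder τ

/-- The event is a disjoint union of cylinders of measure `2⁻¹ ^ n`, so counting strings gives an
exact dyadic value; this supplies the computable approximations below. -/
theorem lebesgue_restrict (p : List Bool → Prop) [DecidablePred p] (n : ℕ) :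
    (lebesgue {Z | p (restrict Z n)}).toReal =
      dyadic (((strings n).filter (p ·)).length, n) := by
  rw [setOf_restrict_eq, MeasureTheory.measure_biUnion_finset]
  · rw [Finset.sum_congr rfl (g := fun _ => (2⁻¹ : ℝ≥0∞) ^ n)]
    · rw [Finset.sum_const, List.toFinset_card_of_nodup ((nodup_strings n).filter _)]
      simp [dyadic, div_eq_mul_inv]
    · intro τ hτ
      rw [lebesgue_cylinder, mem_strings.1 (List.mem_filter.1 (List.mem_toFinset.1 hτ)).1]
  · intro τ hτ τ' hτ' hne
    refine Set.disjoint_left.2 fun Z h h' => hne ?_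
    have l : τ.length = n :=
      mem_strings.1 (List.mem_filter.1 (List.mem_toFinset.1 (Finset.mem_coe.1 hτ))).1
    have l' : τ'.length = n :=
      mem_strings.1 (List.mem_filter.1 (List.mem_toFinset.1 (Finset.mem_coe.1 hτ'))).1
    rw [← mem_cylinder.1 h, ← mem_cylinder.1 h', l, l']
  · exact fun τ _ => measurableSet_cylinder τ

/-! ### The semi-measure induced by a monotone string map -/

/-- The sequences which the string map `Ψ` maps to an extension of `σ`. -/
def preimage (Ψ : List Bool → List Bool) (σ : List Bool) : Set Cantor :=
  {Z | ∃ k, σ <+: Ψ (restrict Z k)}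

/-- The push-forward of the uniform measure under the string map `Ψ`. -/
noncomputable def induced (Ψ : List Bool → List Bool) (σ : List Bool) : ℝ :=
  (lebesgue (preimage Ψ σ)).toReal

section

variable {Ψ : List Bool → List Bool}

theorem preimage_eq_iUnion (σ : List Bool) :
    preimage Ψ σ = ⋃ k, {Z | σ <+: Ψ (restrict Z k)} := by
  ext Z
  simp [preimage]

theorem measurableSet_preimage (σ : List Bool) : MeasurableSet (preimage Ψ σ) := by
  rw [preimage_eq_iUnion]
  exact MeasurableSet.iUnion fun k => measurableSet_restrict (fun τ => σ <+: Ψ τ) k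

theorem monotone_prefix (mono : ∀ τ τ', τ <+: τ' → Ψ τ <+: Ψ τ') (σ : List Bool) :
    Monotone fun k => {Z | σ <+: Ψ (restrict Z k)} :=
  fun _ _ hk Z hZ => List.IsPrefix.trans hZ (mono _ _ (restrict_prefix Z hk))

/-- On a common oracle, both strings would be prefixes of one later output, hence equal. -/
theorem preimage_disjoint (mono : ∀ τ τ', τ <+: τ' → Ψ τ <+: Ψ τ') {σ σ' : List Bool}
    (hl : σ.length = σ'.length) (hne : σ ≠ σ') : Disjoint (preimage Ψ σ) (preimage Ψ σ') := by
  refine Set.disjoint_left.2 ?_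
  rintro Z ⟨k, hk⟩ ⟨k', hk'⟩
  have h := monotone_prefix mono σ (le_max_left k k') hk
  have h' := monotone_prefix mono σ' (le_max_right k k') hk'
  exact hne ((List.prefix_of_prefix_length_le h h' hl.le).eq_of_length hl)

theorem isSemimeasure_induced (mono : ∀ τ τ', τ <+: τ' → Ψ τ <+: Ψ τ') :
    IsSemimeasure (induced Ψ) where
  mem_Icc σ := ⟨ENNReal.toReal_nonneg, MeasureTheory.measureReal_le_one⟩
  root := by
    have : preimage Ψ [] = Set.univ := by
      ext Z
      simp [preimage]
    simp [induced, this]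
  split σ := by
    unfold induced
    rw [← ENNReal.toReal_add (MeasureTheory.measure_ne_top _ _)
      (MeasureTheory.measure_ne_top _ _), ← MeasureTheory.measure_union
        (preimage_disjoint mono (by simp) (by simp)) (measurableSet_preimage _)]
    refine ENNReal.toReal_mono (MeasureTheory.measure_ne_top _ _)
      (MeasureTheory.measure_mono (Set.union_subset ?_ ?_)) <;>
    exact fun Z ⟨k, hk⟩ => ⟨k, (List.prefix_append _ _).trans hk⟩

/-- Stage `i` counts the oracle strings of length `i` whose output extends `σ`. These events
increase with `i` to the whole preimage, and measure is continuous from below. -/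
theorem isLowerSemicomputable_induced (hΨ : Primrec Ψ)
    (mono : ∀ τ τ', τ <+: τ' → Ψ τ <+: Ψ τ') : IsLowerSemicomputable (induced Ψ) := by
  have eq : ∀ σ i, dyadic (((strings i).filter (fun τ => σ <+: Ψ τ)).length, i) =
      (lebesgue {Z | σ <+: Ψ (restrict Z i)}).toReal :=
    fun σ i => (lebesgue_restrict (fun τ => σ <+: Ψ τ) i).symm
  refine ⟨fun σ i => (((strings i).filter (fun τ => σ <+: Ψ τ)).length, i), ?_, ?_, ?_⟩
  · refine Primrec.to_comp (Primrec.pair (Primrec.list_length.comp ?_) Primrec.snd)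
    have : PrimrecRel fun τ σ : List Bool => σ <+: Ψ τ :=
      primrecRel_prefix.comp Primrec.snd (hΨ.comp Primrec.fst)
    exact this.listFilter.comp (primrec_strings.comp Primrec.snd) Primrec.fst
  · intro σ i j hij
    simp only [eq]
    exact ENNReal.toReal_mono (MeasureTheory.measure_ne_top _ _)
      (MeasureTheory.measure_mono (monotone_prefix mono σ hij))
  · intro σ
    simp only [eq]
    refine (ENNReal.tendsto_toReal (MeasureTheory.measure_ne_top _ _)).comp ?_
    rw [preimage_eq_iUnion]
    exact MeasureTheory.tendsto_measure_iUnion_atTop (monotone_prefix mono σ)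

end

/-! ### Recursively enumerable predicates -/

theorem rePred_exists {α : Type*} [Primcodable α] {p : α → ℕ → Bool} (hp : Computable₂ p) :
    REPred fun a => ∃ n, p a n = true := by
  refine (Partrec.dom_re (Partrec.rfind hp.partrec₂)).of_eq fun a => ?_
  rw [Nat.rfind_dom']
  simp

/-- A recursively enumerable predicate has a primitive recursive increasing approximation. -/
theorem exists_stages {α : Type*} [Primcodable α] {p : α → Prop} (hp : REPred p) :
    ∃ D : α → ℕ → Bool, Primrec₂ D ∧ (∀ a s t, s ≤ t → D a s = true → D a t = true) ∧
      ∀ a, p a ↔ ∃ s, D a s = true := by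
  obtain ⟨c, hc⟩ := Nat.Partrec.Code.exists_code.1 hp
  refine ⟨fun a s => (Nat.Partrec.Code.evaln s c (Encodable.encode a)).isSome, ?_, ?_, ?_⟩
  · exact Primrec.option_isSome.comp (Nat.Partrec.Code.primrec_evaln.comp
      (Primrec.pair (Primrec.pair Primrec.snd (Primrec.const c))
        (Primrec.encode.comp Primrec.fst)))
  · intro a s t hst h
    obtain ⟨x, hx⟩ := Option.isSome_iff_exists.1 h
    exact Option.isSome_iff_exists.2 ⟨x, Nat.Partrec.Code.evaln_mono hst hx⟩
  · intro a
    have h1 : p a ↔ (Nat.Partrec.Code.eval c (Encodable.encode a)).Dom := by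
      rw [hc]
      simp [Part.assert]
    rw [h1, Part.dom_iff_mem]
    simp only [Nat.Partrec.Code.evaln_complete, Option.isSome_iff_exists, Option.mem_def]
    exact exists_comm

/-! ### The complement of the canonical tree -/

theorem isClopen_restrict (p : List Bool → Prop) (n : ℕ) : IsClopen {Z | p (restrict Z n)} := by
  have h : {Z : Cantor | p (restrict Z n)} =
      (fun (Z : Cantor) (i : Fin n) => Z i) ⁻¹' {v | p (List.ofFn v)} := by
    ext Z
    have : restrict Z n = List.ofFn fun i : Fin n => Z i :=
      List.ext_getElem (by simp) fun i h1 h2 => by simp [restrict]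
    simp [this]
  rw [h]
  exact (isClopen_discrete _).preimage (by fun_prop)

theorem restrict_getD (τ : List Bool) : restrict (fun i => τ.getD i false) τ.length = τ :=
  List.ext_getElem (by simp) fun i h1 h2 => by simp [restrict, h2]

theorem mem_openOf {S : Set (List Bool)} {Z : Cantor} :
    Z ∈ openOf S ↔ ∃ k, restrict Z k ∈ S := by
  simp only [openOf, Set.mem_iUnion, mem_cylinder, exists_prop]
  exact ⟨fun ⟨τ, h, hτ⟩ => ⟨_, hτ.symm ▸ h⟩, fun ⟨j, h⟩ => ⟨_, h, by simp⟩⟩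

/-- Stage `n` of the enumeration of the strings `σ` whose cylinder is covered by the open set with
approximation `D`. -/
def CoveredAt (D : List Bool → ℕ → Bool) (σ : List Bool) (n : ℕ) : Prop :=
  σ.length ≤ n ∧ ∀ τ ∈ strings n, σ <+: τ → ∃ j < τ.length + 1, D (τ.take j) τ.length = true

theorem primrecRel_coveredAt {D : List Bool → ℕ → Bool} (hD : Primrec₂ D) :
    PrimrecRel (CoveredAt D) := by
  have h1 : PrimrecRel fun (j : ℕ) (τ : List Bool) => D (τ.take j) τ.length = true :=
    Primrec.eq.comp (hD.comp (Primrec.list_take.comp Primrec.fst Primrec.snd)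
      (Primrec.list_length.comp Primrec.snd)) (Primrec.const true)
  have h2 : PrimrecPred fun τ : List Bool => ∃ j < τ.length + 1, D (τ.take j) τ.length = true :=
    (h1.exists_mem_list.comp (Primrec.list_range.comp (Primrec.succ.comp Primrec.list_length))
      Primrec.id).of_eq fun τ => by simp
  have h3 : PrimrecRel fun τ σ : List Bool =>
      σ <+: τ → ∃ j < τ.length + 1, D (τ.take j) τ.length = true :=
    ((primrecRel_prefix.comp Primrec.snd Primrec.fst).not.or (h2.comp Primrec.fst)).of_eq
      fun _ => imp_iff_not_or.symm
  exact (Primrec.nat_le.comp (Primrec.list_length.comp Primrec.fst) Primrec.snd).and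
    (h3.forall_mem_list.comp (primrec_strings.comp Primrec.snd) Primrec.fst)

/-- Compactness: the stages of the open set form an increasing sequence of clopen sets, so a
cylinder covered by their union is covered by one of them, which is a finite check. -/
theorem cylinder_subset_openOf_iff {S : Set (List Bool)} {D : List Bool → ℕ → Bool}
    (mono : ∀ a s t, s ≤ t → D a s = true → D a t = true)
    (hS : ∀ σ, σ ∈ S ↔ ∃ s, D σ s = true) (σ : List Bool) :
    cylinder σ ⊆ openOf S ↔ ∃ n, CoveredAt D σ n := by
  constructor
  · intro h
    let W : ℕ → Set Cantor := fun n =>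
      {Z | ∃ j < n + 1, D (restrict Z j) n = true}
    have hW : ∀ n, W n = {Z | (fun τ : List Bool =>
        ∃ j < n + 1, D (τ.take j) n = true) (restrict Z n)} := by
      intro n
      ext Z
      refine exists_congr fun j => and_congr_right fun hj => ?_
      rw [take_restrict Z (Nat.le_of_lt_succ hj)]
    have Wmono : Monotone W := fun m n hmn Z ⟨j, hj, hD⟩ =>
      ⟨j, by omega, mono _ _ _ hmn hD⟩
    have hc : IsCompact (cylinder σ) :=
      (isClopen_restrict (fun τ => τ = σ) σ.length).isClosed.isCompact
    obtain ⟨n, hn⟩ := hc.elim_directed_cover W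
      (fun n => by rw [hW]; exact (isClopen_restrict (fun τ => ∃ j < n + 1, D (τ.take j) n = true) n).isOpen) (fun Z hZ => by
        obtain ⟨j, hj⟩ := mem_openOf.1 (h hZ)
        obtain ⟨s, hs⟩ := (hS _).1 hj
        exact Set.mem_iUnion.2 ⟨max j s, j, by omega, mono _ _ _ (le_max_right _ _) hs⟩)
      Wmono.directed_le
    -- The level must reach `σ.length` so that the strings extending `σ` split up its whole
    -- cylinder.
    refine ⟨max n σ.length, le_max_right _ _, fun τ hτ hστ => ?_⟩
    rw [mem_strings] at hτ
    have hZ := restrict_getD τ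
    generalize (fun i => τ.getD i false : Cantor) = Z at hZ
    have hZσ : Z ∈ cylinder σ := by
      rw [mem_cylinder, ← take_restrict Z hστ.length_le, hZ]
      exact (List.prefix_iff_eq_take.1 hστ).symm
    obtain ⟨j, hj, hD⟩ := Wmono (le_max_left n σ.length) (hn hZσ)
    rw [← hτ] at hj hD
    refine ⟨j, hj, ?_⟩
    rwa [← take_restrict Z (Nat.le_of_lt_succ hj), hZ] at hD
  · rintro ⟨n, hn, h⟩ Z hZ
    have hp : σ <+: restrict Z n := by
      rw [← mem_cylinder.1 hZ]
      exact restrict_prefix Z hn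
    obtain ⟨j, hj, hD⟩ := h _ (mem_strings.2 (length_restrict Z n)) hp
    rw [length_restrict] at hj
    rw [take_restrict Z (Nat.le_of_lt_succ hj)] at hD
    exact mem_openOf.2 ⟨j, (hS _).2 ⟨_, hD⟩⟩

/-- The canonical tree of a `Π⁰₁` class is co-c.e. -/
theorem IsPi01.exists_coTree {C : Set Cantor} (hC : IsPi01 C) :
    ∃ E : List Bool → ℕ → Bool, Primrec₂ E ∧
      ∀ σ, σ ∉ canonicalTree C ↔ ∃ n, E σ n = true := by
  classical
  obtain ⟨S, hS, rfl⟩ := hC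
  obtain ⟨D, hD, mono, hSD⟩ := exists_stages hS
  refine ⟨fun σ n => decide (CoveredAt D σ n), (primrecRel_coveredAt hD).decide, fun σ => ?_⟩
  simp only [decide_eq_true_eq]
  rw [← cylinder_subset_openOf_iff mono hSD, canonicalTree, Set.mem_ofPred_eq,
    Set.not_nonempty_iff_eq_empty, ← Set.sdiff_eq, Set.sdiff_eq_empty]

/-! ### The difference test -/

/-- A string map induces a semi-measure dominated by `M`, so the sequences mapped into the level
`n` of a set of strings have measure at most a constant times the `M`-mass of that level. -/
theorem exists_lebesgue_le_mass {M : List Bool → ℝ} (hM : IsUniversalSemimeasure M)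
    {Ψ : List Bool → List Bool} (hΨ : Primrec Ψ) (mono : ∀ τ τ', τ <+: τ' → Ψ τ <+: Ψ τ') :
    ∃ c : ℕ, ∀ S : Set (List Bool), lebesgue (⋃ σ ∈ S, preimage Ψ σ) ≤ c * mass M S := by
  obtain ⟨c, hc⟩ := hM.universal _ (isSemimeasure_induced mono)
    (isLowerSemicomputable_induced hΨ mono)
  refine ⟨c, fun S => ?_⟩
  refine (MeasureTheory.measure_biUnion_le _ S.to_countable _).trans ?_
  rw [mass, ← ENNReal.tsum_mul_left]
  refine ENNReal.tsum_le_tsum fun σ => ?_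
  rw [← ENNReal.ofReal_toReal (MeasureTheory.measure_ne_top lebesgue (preimage Ψ σ))]
  refine (ENNReal.ofReal_le_ofReal (hc σ)).trans ?_
  rw [ENNReal.ofReal_mul (Nat.cast_nonneg c), ENNReal.ofReal_natCast]

theorem not_computes_of_isDeep {M : List Bool → ℝ} (hM : IsUniversalSemimeasure M)
    {X : Cantor} (hX : IsDifferenceRandom X) {C : Set Cantor} (hC : IsDeep M C)
    {Y : Cantor} (hY : Y ∈ C) : ¬ Computes X Y := by
  intro h
  obtain ⟨Ψ, hΨ, mono, hXY⟩ := h.exists_stringMap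
  obtain ⟨c, hc⟩ := exists_lebesgue_le_mass hM hΨ mono
  obtain ⟨hpi, f, hf, hmass⟩ := hC
  obtain ⟨E, hE, hEC⟩ := hpi.exists_coTree
  -- The shift by `c` absorbs the domination constant, since `c ≤ 2 ^ c`.
  let g : ℕ → ℕ := fun i => f (i + c)
  have hg : Computable g := hf.comp (Primrec.nat_add.comp Primrec.id (Primrec.const c)).to_comp
  let U : ℕ → Set Cantor := fun i => openOf {τ | g i ≤ (Ψ τ).length}
  let V : ℕ → Set Cantor := fun i =>
    openOf {τ | g i ≤ (Ψ τ).length ∧ (Ψ τ).take (g i) ∉ canonicalTree C}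
  have hle : Computable fun p : ℕ × List Bool => decide (g p.1 ≤ (Ψ p.2).length) :=
    (Primrec.nat_le.decide.to_comp).comp (hg.comp Computable.fst)
      ((Primrec.list_length.comp hΨ).to_comp.comp Computable.snd)
  have hsub : ∀ i, U i \ V i ⊆ ⋃ σ ∈ level (canonicalTree C) (g i), preimage Ψ σ := by
    rintro i Z ⟨hU, hV⟩
    obtain ⟨k, hk⟩ := mem_openOf.1 hU
    refine Set.mem_biUnion (x := (Ψ (restrict Z k)).take (g i)) ⟨?_, by simpa using hk⟩
      ⟨k, List.take_prefix _ _⟩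
    by_contra hT
    exact hV (mem_openOf.2 ⟨k, hk, hT⟩)
  have htest : IsDifferenceTest U V :=
    { sigma_left := by
        refine ⟨fun i => {τ | g i ≤ (Ψ τ).length}, ?_, fun i => rfl⟩
        exact (rePred_exists (p := fun (q : ℕ × List Bool) _ => decide (g q.1 ≤ (Ψ q.2).length))
          (hle.comp Computable.fst)).of_eq fun q => by simp
      sigma_right := by
        refine ⟨fun i => {τ | g i ≤ (Ψ τ).length ∧ (Ψ τ).take (g i) ∉ canonicalTree C}, ?_,
          fun i => rfl⟩
        refine (rePred_exists (p := fun (q : ℕ × List Bool) n =>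
          decide (g q.1 ≤ (Ψ q.2).length) && E ((Ψ q.2).take (g q.1)) n) ?_).of_eq fun q => ?_
        · refine Primrec.and.to_comp.comp (hle.comp Computable.fst) (hE.to_comp.comp ?_
            Computable.snd)
          exact Primrec.list_take.to_comp.comp
            (hg.comp (Computable.fst.comp Computable.fst))
            (hΨ.to_comp.comp (Computable.snd.comp Computable.fst))
        · simp [hEC]
      measure_le := fun i => by
        refine (MeasureTheory.measure_mono (hsub i)).trans ((hc _).trans ?_)
        have hc2 : (c : ℝ≥0∞) ≤ 2 ^ c := mod_cast (Nat.lt_two_pow_self (n := c)).le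
        calc (c : ℝ≥0∞) * mass M (level (canonicalTree C) (f (i + c)))
            ≤ 2 ^ c * 2⁻¹ ^ (i + c) := mul_le_mul' hc2 (hmass (i + c)).le
          _ = 2⁻¹ ^ i * (2 * 2⁻¹) ^ c := by rw [mul_pow, pow_add]; ring
          _ = 2⁻¹ ^ i := by
            rw [ENNReal.mul_inv_cancel two_ne_zero ENNReal.ofNat_ne_top, one_pow, mul_one] }
  refine hX U V htest (Set.mem_iInter.2 fun i => ⟨?_, fun hV => ?_⟩)
  · obtain ⟨k, hk⟩ := hXY (g i)
    exact mem_openOf.2 ⟨k, by simpa using hk.length_le⟩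
  · obtain ⟨k, hk, hT⟩ := mem_openOf.1 hV
    obtain ⟨l, hl⟩ := hXY (g i)
    -- The truncated output and `restrict Y (g i)` are prefixes of the same later output and have
    -- equal length, so they coincide; but a prefix of `Y ∈ C` lies in the tree.
    have h1 := (List.take_prefix (g i) _).trans (mono _ _ (restrict_prefix X (le_max_left k l)))
    have h2 := hl.trans (mono _ _ (restrict_prefix X (le_max_right k l)))
    have hlen : ((Ψ (restrict X k)).take (g i)).length = (restrict Y (g i)).length := by
      simpa using hk
    have he := (List.prefix_of_prefix_length_le h1 h2 hlen.le).eq_of_length hlen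
    rw [he] at hT
    exact hT ⟨Y, by simp [mem_cylinder], hY⟩

end DeepClass

theorem mainTheorem1 (M : List Bool → ℝ) (hM : DeepClass.IsUniversalSemimeasure M)
    (X : DeepClass.Cantor) (hX : DeepClass.IsDifferenceRandom X)
    (C : Set DeepClass.Cantor) (hC : DeepClass.IsDeep M C) :
    ¬ ∃ Y ∈ C, DeepClass.Computes X Y :=
  fun ⟨_, hY, h⟩ => DeepClass.not_computes_of_isDeep hM hX hC hY h
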